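/- Theorem (Effective Hypercube Nullstellensatz). Let $n \ge 0$ be an integer and let $g_1, g_2 \in \mathbb{R}[X_1,\dots,X_n]$. Suppose that $g_1$ and $g_2$ have no common zero on the hypercube $\{0,1\}^n$, and that $g_1(x)\, g_2(x) = 0$ for all $x \in \{0,1\}^n$. Then there exist $h_1, h_2 \in \mathbb{R}[X_1,\dots,X_n]$ such that $$h_1(x) g_1(x) + h_2(x) g_2(x) = 1 \quad \text{for all } x \in \{0,1\}^n$$ and $$\max\bigl(\deg(\overline{h_1 g_1}),\, \deg(\overline{h_2 g_2})\bigr) \le 2 \deg(g_1)^2 \deg(g_2)^2.$$ Here $\deg$ denotes the total degree, with the convention $\deg(0) = 0$, and $\overline{p}$ denotes the multilinearization of $p$, that is, the polynomial obtained from $p$ by using the relations $X_1^2 = X_1, \dots, X_n^2 = X_n$ to replace every positive exponent in every monomial by $1$. -/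

import Mathlib

/-- The hypercube `{0,1}ⁿ`, as a set of points of `ℝⁿ`. -/
def hypercube (n : ℕ) : Set (Fin n → ℝ) :=
  {x | ∀ i, x i = 0 ∨ x i = 1}

/-- The multilinearization of a polynomial, obtained from the relations `X i ^ 2 = X i`: in each
monomial, every positive exponent is replaced by `1` (and like terms are then collected). -/
noncomputable def multilinearization {n : ℕ} (p : MvPolynomial (Fin n) ℝ) :
    MvPolynomial (Fin n) ℝ :=
  ∑ d ∈ p.support, MvPolynomial.C (p.coeff d) * ∏ i ∈ d.support, MvPolynomial.X i

/-!
Let `F` and `G` be the functions on the cube given by `g₁` and `g₂`, of degrees `d` and `m`. Taking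
for `h₁` and `h₂` the interpolants of the pointwise inverses, `h₁ g₁` and `h₂ g₂` become the
indicators of `F ≠ 0` and `G ≠ 0`, which add up to `1`; so it suffices that the indicator of `F ≠ 0`
has low degree.

Choose a maximal family of pairwise disjoint monomials of degree `m` in `G`, and let `|F|` be
largest at `y`. Inside each of these monomials there is a block of coordinates whose flip moves `y`
to a point where `G ≠ 0`, hence `F = 0`. Averaging `F` over random flips of the blocks, each with
probability `t`, gives a polynomial in `t` of degree at most `d`, bounded by `|F y|` on `[0, 1]`,
whose derivative at `0` is minus the number of blocks times `F y`. By Markov's inequality there are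
at most `2 d²` blocks. Their monomials involve at most `2 d² m` variables and, by maximality, meet
every monomial of degree `m`, so fixing these variables lowers the degree of `G`. Induction on `m`
bounds the degree of the indicator by `∑ k ≤ m, 2 d² k = d² m (m + 1) ≤ 2 d² m²`.
-/

section EndpointDerivative

open Polynomial

theorem abs_derivative_eval_one_le_sq {P : ℝ[X]} {d : ℕ} (hdeg : P.natDegree ≤ d)
    (hP : ∀ t ∈ Set.Icc (-1 : ℝ) 1, |P.eval t| ≤ 1) : |P.derivative.eval 1| ≤ d ^ 2 := by
  have derivative_le {Q : ℝ[X]} (hQdeg : Q.natDegree ≤ d)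
      (hQ : ∀ t ∈ Set.Icc (-1 : ℝ) 1, |Q.eval t| ≤ 1) : Q.derivative.eval 1 ≤ d ^ 2 := by
    simpa [Chebyshev.derivative_T_eval_one] using
      Chebyshev.eval_iterate_derivative_le_of_forall_abs_le_one (k := 1) le_rfl
        (degree_le_of_natDegree_le hQdeg) hQ
  refine abs_le'.2 ⟨derivative_le hdeg hP, ?_⟩
  simpa using derivative_le (Q := -P) (by simpa using hdeg) (by simpa using hP)

theorem abs_derivative_eval_zero_le {P : ℝ[X]} {d : ℕ} (hdeg : P.natDegree ≤ d) {K : ℝ}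
    (hK : 0 < K) (hP : ∀ t ∈ Set.Icc (0 : ℝ) 1, |P.eval t| ≤ K) :
    |P.derivative.eval 0| ≤ 2 * d ^ 2 * K := by
  -- `t ↦ (1 - t) / 2` maps `[-1, 1]` onto `[0, 1]` and sends `1` to `0`.
  set Q : ℝ[X] := C K⁻¹ * P.comp (C (1 / 2) - C (1 / 2) * X) with hQ
  have hQdeg : Q.natDegree ≤ d := by
    have hlin : (C (1 / 2 : ℝ) - C (1 / 2) * X).natDegree ≤ 1 := by compute_degree
    calc Q.natDegree ≤ P.natDegree * (C (1 / 2 : ℝ) - C (1 / 2) * X).natDegree :=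
          (natDegree_C_mul_le _ _).trans natDegree_comp_le
      _ ≤ d * 1 := Nat.mul_le_mul hdeg hlin
      _ = d := mul_one d
  have hQbound : ∀ t ∈ Set.Icc (-1 : ℝ) 1, |Q.eval t| ≤ 1 := fun t ht => by
    have := hP (1 / 2 - 1 / 2 * t) ⟨by linarith [ht.2], by linarith [ht.1]⟩
    simpa [hQ, abs_mul, abs_of_pos hK, inv_mul_le_iff₀ hK] using this
  have hderiv : Q.derivative.eval 1 = -(K⁻¹ * (P.derivative.eval 0 / 2)) := by
    simp only [hQ, derivative_C_mul, derivative_comp, derivative_sub, derivative_C, derivative_X,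
      eval_mul, eval_C, eval_comp, eval_sub, eval_X, eval_zero, mul_one, sub_self]
    ring
  have hmarkov := abs_derivative_eval_one_le_sq hQdeg hQbound
  rw [hderiv, abs_neg, abs_mul, abs_div, abs_of_pos (inv_pos.2 hK), abs_two,
    inv_mul_le_iff₀ hK] at hmarkov
  linarith

end EndpointDerivative

open Finset

section CubeFunctions

variable {R : Type*} [CommRing R] {σ τ : Type*} [DecidableEq σ] [DecidableEq τ]

variable (R) in
/-- The square-free monomial `∏ i ∈ J, xᵢ` as a function on the cube `{0,1}^σ`. A point of the cube
is encoded by its support, a finite subset of `σ`. -/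
def cubeMonomial (J B : Finset σ) : R := if J ⊆ B then 1 else 0

variable (R σ) in
/-- The functions on the cube `{0,1}^σ` given by a polynomial of degree at most `d`. -/
def cubeDegreeLE (d : ℕ) : Submodule R (Finset σ → R) :=
  Submodule.span R (cubeMonomial R '' {J | #J ≤ d})

variable (R) in
/-- The coefficient of the square-free monomial `∏ i ∈ J, xᵢ` in the multilinear polynomial
representing a function on the cube `{0,1}^σ`, given by Möbius inversion. -/
def cubeCoeff (J : Finset σ) : (Finset σ → R) →ₗ[R] R :=
  ∑ B ∈ J.powerset, (-1 : R) ^ #(J \ B) • LinearMap.proj B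

theorem cubeCoeff_apply (J : Finset σ) (F : Finset σ → R) :
    cubeCoeff R J F = ∑ B ∈ J.powerset, (-1) ^ #(J \ B) * F B := by
  simp [cubeCoeff]

theorem cubeMonomial_empty : cubeMonomial R (∅ : Finset σ) = 1 := by
  ext B
  simp [cubeMonomial]

theorem cubeMonomial_mul_cubeMonomial (J K : Finset σ) :
    cubeMonomial R J * cubeMonomial R K = cubeMonomial R (J ∪ K) := by
  ext B
  simp only [cubeMonomial, Pi.mul_apply, union_subset_iff, ite_and, ite_mul, one_mul, zero_mul]

theorem prod_cubeMonomial_singleton (J : Finset σ) :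
    ∏ i ∈ J, cubeMonomial R {i} = cubeMonomial R J := by
  ext B
  simp [cubeMonomial, prod_ite_zero, subset_iff]

theorem cubeCoeff_cubeMonomial (J M : Finset σ) :
    cubeCoeff R M (cubeMonomial R J) = if J = M then 1 else 0 := by
  rw [cubeCoeff_apply]
  by_cases hJM : J ⊆ M
  · have hterm : ∀ B, (-1) ^ #(M \ B) * cubeMonomial R J B =
        (∏ _i ∈ B, 1) * ∏ i ∈ M \ B, if i ∉ J then (-1 : R) else 0 := fun B => by
      have hiff : (∀ i ∈ M \ B, i ∉ J) ↔ J ⊆ B := by grind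
      simp only [prod_ite_zero, hiff, cubeMonomial, prod_const, one_pow, one_mul, mul_ite, mul_one,
        mul_zero]
    calc ∑ B ∈ M.powerset, (-1) ^ #(M \ B) * cubeMonomial R J B
        = ∏ i ∈ M, (1 + if i ∉ J then (-1 : R) else 0) := by
          rw [prod_add, sum_congr rfl fun B _ => hterm B]
      _ = ∏ i ∈ M, if i ∈ J then (1 : R) else 0 := by
          refine prod_congr rfl fun i _ => ?_
          split_ifs <;> simp_all
      _ = if J = M then 1 else 0 := by
          rw [prod_ite_zero, prod_const_one]
          exact if_congr ⟨hJM.antisymm, fun h => h.symm.subset⟩ rfl rfl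
  · rw [if_neg fun h => hJM h.subset]
    refine sum_eq_zero fun B hB => ?_
    rw [cubeMonomial, if_neg fun h => hJM (h.trans (mem_powerset.1 hB)), mul_zero]

theorem cubeMonomial_mem_cubeDegreeLE {J : Finset σ} {d : ℕ} (hJ : #J ≤ d) :
    cubeMonomial R J ∈ cubeDegreeLE R σ d :=
  Submodule.subset_span ⟨J, hJ, rfl⟩

theorem cubeDegreeLE_mono : Monotone (cubeDegreeLE R σ) := fun _ _ h =>
  Submodule.span_mono <| Set.image_mono fun _ hJ => le_trans hJ h

theorem one_mem_cubeDegreeLE (d : ℕ) : (1 : Finset σ → R) ∈ cubeDegreeLE R σ d := by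
  rw [← cubeMonomial_empty]
  exact cubeMonomial_mem_cubeDegreeLE (by simp)

theorem cubeDegreeLE_zero : cubeDegreeLE R σ 0 = Submodule.span R {1} := by
  simp [cubeDegreeLE, cubeMonomial_empty]

theorem mul_mem_cubeDegreeLE {d e : ℕ} {F G : Finset σ → R} (hF : F ∈ cubeDegreeLE R σ d)
    (hG : G ∈ cubeDegreeLE R σ e) : F * G ∈ cubeDegreeLE R σ (d + e) := by
  have hFG := Submodule.mul_mem_mul hF hG
  rw [cubeDegreeLE, cubeDegreeLE, Submodule.span_mul_span] at hFG
  refine Submodule.span_mono ?_ hFG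
  rintro _ ⟨_, ⟨J, hJ, rfl⟩, _, ⟨K, hK, rfl⟩, rfl⟩
  exact ⟨J ∪ K, (card_union_le J K).trans (add_le_add hJ hK),
    (cubeMonomial_mul_cubeMonomial J K).symm⟩

instance : SetLike.GradedMonoid (cubeDegreeLE R σ) where
  one_mem := one_mem_cubeDegreeLE 0
  mul_mem _ _ _ _ := mul_mem_cubeDegreeLE

theorem prod_mem_cubeDegreeLE_card {ι : Type*} {s : Finset ι} {F : ι → Finset σ → R}
    (hF : ∀ i ∈ s, F i ∈ cubeDegreeLE R σ 1) : ∏ i ∈ s, F i ∈ cubeDegreeLE R σ #s := by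
  simpa using SetLike.prod_mem_graded (cubeDegreeLE R σ) (fun _ => 1) F hF

theorem card_le_of_cubeCoeff_ne_zero {d : ℕ} {F : Finset σ → R} (hF : F ∈ cubeDegreeLE R σ d)
    {J : Finset σ} (hJ : cubeCoeff R J F ≠ 0) : #J ≤ d := by
  contrapose! hJ
  have hle : cubeDegreeLE R σ d ≤ LinearMap.ker (cubeCoeff R J) := by
    refine Submodule.span_le.2 <| Set.forall_mem_image.2 fun K hK => ?_
    have hKJ : K ≠ J := by
      rintro rfl
      exact hJ.not_ge hK
    simp [cubeCoeff_cubeMonomial, hKJ]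
  exact hle hF

/-- For `A ⊆ U`, the point of the cube that agrees with `A` on `U` and with `B` off `U`. -/
def overwrite (U A B : Finset σ) : Finset σ := A ∪ B \ U

theorem indicator_inter_eq_mem_cubeDegreeLE {U A : Finset σ} (hA : A ⊆ U) :
    (fun B => if B ∩ U = A then 1 else 0) ∈ cubeDegreeLE R σ #U := by
  have hcoord : ∀ i, cubeMonomial R {i} ∈ cubeDegreeLE R σ 1 := fun i =>
    cubeMonomial_mem_cubeDegreeLE (card_singleton i).le
  have hprod : (fun B => if B ∩ U = A then 1 else 0) =
      ∏ i ∈ U, if i ∈ A then cubeMonomial R {i} else 1 - cubeMonomial R {i} := by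
    ext B
    have hfactor : ∀ i, (if i ∈ A then cubeMonomial R {i} else 1 - cubeMonomial R {i}) B =
        if i ∈ A ↔ i ∈ B then 1 else 0 := fun i => by
      by_cases hiA : i ∈ A <;> by_cases hiB : i ∈ B <;> simp [cubeMonomial, hiA, hiB]
    rw [prod_apply, prod_congr rfl fun i _ => hfactor i, prod_ite_zero, prod_const_one]
    exact if_congr (by grind) rfl rfl
  rw [hprod]
  refine prod_mem_cubeDegreeLE_card fun i _ => ?_
  split_ifs
  exacts [hcoord i, sub_mem (one_mem_cubeDegreeLE 1) (hcoord i)]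

theorem mem_cubeDegreeLE_of_forall_comp_overwrite {U : Finset σ} {e : ℕ} {F : Finset σ → R}
    (hF : ∀ A ⊆ U, F ∘ overwrite U A ∈ cubeDegreeLE R σ e) : F ∈ cubeDegreeLE R σ (#U + e) := by
  have hsplit : F = ∑ A ∈ U.powerset,
      (fun B => if B ∩ U = A then 1 else 0) * F ∘ overwrite U A := by
    ext B
    have hB : overwrite U (B ∩ U) B = B := by
      rw [overwrite, union_comm, sdiff_union_inter]
    simp [hB]
  rw [hsplit]
  exact sum_mem fun A hA => mul_mem_cubeDegreeLE
    (indicator_inter_eq_mem_cubeDegreeLE (mem_powerset.1 hA)) (hF A (mem_powerset.1 hA))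

theorem mem_cubeDegreeLE_card [Fintype σ] (F : Finset σ → R) :
    F ∈ cubeDegreeLE R σ (Fintype.card σ) := by
  refine mem_cubeDegreeLE_of_forall_comp_overwrite (U := univ) (e := 0) fun A _ => ?_
  have hconst : F ∘ overwrite univ A = F A • 1 := by
    ext B
    simp [overwrite, sdiff_eq_empty_iff_subset.2 (subset_univ B)]
  rw [hconst]
  exact Submodule.smul_mem _ _ (one_mem_cubeDegreeLE 0)

theorem sum_cubeCoeff_smul_cubeMonomial [Fintype σ] (F : Finset σ → R) :
    ∑ J, cubeCoeff R J F • cubeMonomial R J = F := by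
  induction mem_cubeDegreeLE_card F using Submodule.span_induction with
  | zero => simp
  | add F G _ _ hF hG => simp only [map_add, add_smul, sum_add_distrib, hF, hG]
  | smul a F _ hF => simp only [map_smul, smul_assoc, ← smul_sum, hF]
  | mem F hF =>
    obtain ⟨J, -, rfl⟩ := hF
    simp [cubeCoeff_cubeMonomial]

theorem mem_span_cubeMonomial_of_cubeCoeff_ne_zero [Finite σ] (F : Finset σ → R) :
    F ∈ Submodule.span R (cubeMonomial R '' {J | cubeCoeff R J F ≠ 0}) := by
  cases nonempty_fintype σ
  have hterm : ∀ J, cubeCoeff R J F • cubeMonomial R J ∈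
      Submodule.span R (cubeMonomial R '' {J | cubeCoeff R J F ≠ 0}) := fun J => by
    by_cases hJ : cubeCoeff R J F = 0
    · simp [hJ]
    · exact Submodule.smul_mem _ _ (Submodule.subset_span ⟨J, hJ, rfl⟩)
  have hsum := sum_mem fun J (_ : J ∈ univ) => hterm J
  rwa [sum_cubeCoeff_smul_cubeMonomial] at hsum

theorem comp_mem_of_mem_span_cubeMonomial {α : Type*} {s : Set (Finset σ)} {φ : α → Finset σ}
    {N : Submodule R (α → R)} (hφ : ∀ J ∈ s, cubeMonomial R J ∘ φ ∈ N)
    {F : Finset σ → R} (hF : F ∈ Submodule.span R (cubeMonomial R '' s)) : F ∘ φ ∈ N := by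
  have hle : Submodule.span R (cubeMonomial R '' s) ≤ N.comap (LinearMap.funLeft R R φ) :=
    Submodule.span_le.2 (Set.forall_mem_image.2 hφ)
  exact hle hF

theorem comp_mem_cubeDegreeLE {d : ℕ} {F : Finset σ → R} (hF : F ∈ cubeDegreeLE R σ d)
    {φ : Finset τ → Finset σ} (hφ : ∀ i, cubeMonomial R {i} ∘ φ ∈ cubeDegreeLE R τ 1) :
    F ∘ φ ∈ cubeDegreeLE R τ d := by
  refine comp_mem_of_mem_span_cubeMonomial (fun J hJ => ?_) hF
  have hprod : cubeMonomial R J ∘ φ = ∏ i ∈ J, cubeMonomial R {i} ∘ φ := by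
    rw [← prod_cubeMonomial_singleton]
    ext B
    simp
  rw [hprod]
  exact cubeDegreeLE_mono hJ (prod_mem_cubeDegreeLE_card fun i _ => hφ i)

theorem cubeMonomial_comp_overwrite (U A J : Finset σ) :
    cubeMonomial R J ∘ overwrite U A =
      if Disjoint (J \ A) U then cubeMonomial R (J \ A) else 0 := by
  ext B
  have hiff : J ⊆ A ∪ B \ U ↔ Disjoint (J \ A) U ∧ J \ A ⊆ B := by
    grind [disjoint_left]
  simp only [Function.comp_apply, cubeMonomial, overwrite, hiff, ite_and]
  split_ifs <;> simp_all [cubeMonomial]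

theorem comp_overwrite_mem_cubeDegreeLE {d : ℕ} {F : Finset σ → R}
    (hF : F ∈ cubeDegreeLE R σ d) (U A : Finset σ) : F ∘ overwrite U A ∈ cubeDegreeLE R σ d := by
  refine comp_mem_of_mem_span_cubeMonomial (fun J hJ => ?_) hF
  rw [cubeMonomial_comp_overwrite]
  split_ifs
  · exact cubeMonomial_mem_cubeDegreeLE ((card_le_card sdiff_subset).trans hJ)
  · exact zero_mem _

theorem comp_overwrite_mem_cubeDegreeLE_of_hitting [Finite σ] {m : ℕ} {G : Finset σ → R}
    (hG : G ∈ cubeDegreeLE R σ (m + 1)) {U : Finset σ}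
    (hU : ∀ J, #J = m + 1 → cubeCoeff R J G ≠ 0 → ¬ Disjoint J U) (A : Finset σ) :
    G ∘ overwrite U A ∈ cubeDegreeLE R σ m := by
  refine comp_mem_of_mem_span_cubeMonomial (fun J hJ => ?_)
    (mem_span_cubeMonomial_of_cubeCoeff_ne_zero G)
  rw [cubeMonomial_comp_overwrite]
  split_ifs with hdisj
  · refine cubeMonomial_mem_cubeDegreeLE ?_
    rcases (card_le_of_cubeCoeff_ne_zero hG hJ).lt_or_eq with hlt | htop
    · exact (card_le_card sdiff_subset).trans (Nat.le_of_lt_succ hlt)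
    · have hne : J \ A ≠ J := fun h => hU J htop hJ (h ▸ hdisj)
      have hlt := card_lt_card (sdiff_subset.ssubset_of_ne hne)
      omega
  · exact zero_mem _

theorem cubeCoeff_comp_overwrite {G : Finset σ → R} {M : Finset σ}
    (hG : G ∈ cubeDegreeLE R σ #M) (y : Finset σ) :
    cubeCoeff R M (fun A => G (overwrite M A y)) = cubeCoeff R M G := by
  have hle : cubeDegreeLE R σ #M ≤ LinearMap.eqLocus
      (cubeCoeff R M ∘ₗ LinearMap.funLeft R R fun A => overwrite M A y) (cubeCoeff R M) := by
    refine Submodule.span_le.2 <| Set.forall_mem_image.2 fun J hJ => ?_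
    have hcomp : (fun A => cubeMonomial R J (overwrite M A y)) = cubeMonomial R (J \ (y \ M)) := by
      ext A
      have hsubset : J ⊆ A ∪ y \ M ↔ J \ (y \ M) ⊆ A := by grind
      simp only [cubeMonomial, overwrite, hsubset]
    have hiff : J \ (y \ M) = M ↔ J = M := by
      refine ⟨fun h => (eq_of_subset_of_card_le ?_ hJ).symm, ?_⟩
      · exact h ▸ sdiff_subset
      · rintro rfl
        exact sdiff_eq_self_of_disjoint disjoint_sdiff
    change cubeCoeff R M (fun A => cubeMonomial R J (overwrite M A y)) = _
    simp only [hcomp, cubeCoeff_cubeMonomial, hiff]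
  exact hle hG

theorem exists_subset_symmDiff_ne_zero {G : Finset σ → R} {M : Finset σ}
    (hG : G ∈ cubeDegreeLE R σ #M) (hM : cubeCoeff R M G ≠ 0) (y : Finset σ) :
    ∃ D ⊆ M, G (symmDiff y D) ≠ 0 := by
  rw [← cubeCoeff_comp_overwrite hG y, cubeCoeff_apply] at hM
  obtain ⟨A, hA, hne⟩ := exists_ne_zero_of_sum_ne_zero hM
  refine ⟨symmDiff y (overwrite M A y), ?_, ?_⟩
  · have := mem_powerset.1 hA
    grind [overwrite, mem_symmDiff]
  · rw [symmDiff_symmDiff_cancel_left]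
    exact right_ne_zero_of_mul hne

theorem comp_symmDiff_biUnion_mem_cubeDegreeLE {d : ℕ} {F : Finset σ → R}
    (hF : F ∈ cubeDegreeLE R σ d) (y : Finset σ) {D : τ → Finset σ}
    (hD : Pairwise (Function.onFun Disjoint D)) :
    (F ∘ fun B : Finset τ => symmDiff y (B.biUnion D)) ∈ cubeDegreeLE R τ d := by
  refine comp_mem_cubeDegreeLE hF fun i => ?_
  by_cases hi : ∃ k, i ∈ D k
  · obtain ⟨k, hk⟩ := hi
    have hmem : ∀ B : Finset τ, i ∈ B.biUnion D ↔ k ∈ B := fun B => by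
      have hunique : ∀ l, i ∈ D l → l = k := fun l hl => by
        by_contra hlk
        exact disjoint_left.1 (hD hlk) hl hk
      grind
    have hcoord : cubeMonomial R {k} ∈ cubeDegreeLE R τ 1 :=
      cubeMonomial_mem_cubeDegreeLE (card_singleton k).le
    by_cases hy : i ∈ y
    · convert sub_mem (one_mem_cubeDegreeLE 1) hcoord using 1
      ext B
      by_cases hB : k ∈ B <;> simp [cubeMonomial, mem_symmDiff, -mem_biUnion, hmem, hy, hB]
    · convert hcoord using 1
      ext B
      simp [cubeMonomial, mem_symmDiff, -mem_biUnion, hmem, hy]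
  · have hconst : (cubeMonomial R {i} ∘ fun B : Finset τ => symmDiff y (B.biUnion D)) =
        cubeMonomial R {i} y • 1 := by
      ext B
      have hB : i ∉ B.biUnion D := by grind
      simp [cubeMonomial, mem_symmDiff, -mem_biUnion, hB]
    rw [hconst]
    exact Submodule.smul_mem _ _ (one_mem_cubeDegreeLE 1)

end CubeFunctions

section DiagonalPolynomial

open Polynomial

variable {R : Type*} [CommRing R] {σ : Type*} [DecidableEq σ] [Fintype σ]

variable (R σ) in
/-- The restriction to the diagonal `(t, …, t)` of the multilinear extension of a function on the
cube `{0,1}^σ`. Its value at `t` is the mean of the function over a random point whose coordinates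
are independently `1` with probability `t`. -/
noncomputable def diagonalPolynomial : (Finset σ → R) →ₗ[R] R[X] :=
  ∑ B, (LinearMap.proj B).smulRight (X ^ #B * (1 - X) ^ #Bᶜ)

theorem diagonalPolynomial_apply (F : Finset σ → R) :
    diagonalPolynomial R σ F = ∑ B, F B • (X ^ #B * (1 - X) ^ #Bᶜ) := by
  simp [diagonalPolynomial]

theorem diagonalPolynomial_cubeMonomial (J : Finset σ) :
    diagonalPolynomial R σ (cubeMonomial R J) = X ^ #J := by
  have hterm : ∀ B, cubeMonomial R J B • (X ^ #B * (1 - X) ^ #Bᶜ) =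
      (∏ _i ∈ B, X) * ∏ i ∈ univ \ B, if i ∉ J then 1 - (X : R[X]) else 0 := fun B => by
    have hiff : (∀ i ∈ univ \ B, i ∉ J) ↔ J ⊆ B := by grind
    rw [prod_ite_zero]
    simp only [hiff, cubeMonomial, compl_eq_univ_sdiff, prod_const, mul_ite, ite_smul, one_smul,
      zero_smul, mul_zero]
  calc diagonalPolynomial R σ (cubeMonomial R J)
      = ∏ i, (X + if i ∉ J then 1 - (X : R[X]) else 0) := by
        rw [diagonalPolynomial_apply, prod_add, powerset_univ, sum_congr rfl fun B _ => hterm B]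
    _ = ∏ i, if i ∈ J then (X : R[X]) else 1 := by
        refine prod_congr rfl fun i _ => ?_
        split_ifs <;> simp_all
    _ = X ^ #J := by simp [prod_ite_mem]

theorem natDegree_diagonalPolynomial_le {d : ℕ} {F : Finset σ → R}
    (hF : F ∈ cubeDegreeLE R σ d) : (diagonalPolynomial R σ F).natDegree ≤ d := by
  rw [natDegree_le_iff_degree_le, ← mem_degreeLE]
  have hle : cubeDegreeLE R σ d ≤ (degreeLE R d).comap (diagonalPolynomial R σ) := by
    refine Submodule.span_le.2 <| Set.forall_mem_image.2 fun J hJ => ?_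
    rw [SetLike.mem_coe, Submodule.mem_comap, diagonalPolynomial_cubeMonomial, mem_degreeLE]
    exact (degree_X_pow_le _).trans (by exact_mod_cast hJ)
  exact hle hF

theorem derivative_diagonalPolynomial_eval_zero (F : Finset σ → R) :
    (diagonalPolynomial R σ F).derivative.eval 0 = ∑ i, (F {i} - F ∅) := by
  have hexpand : diagonalPolynomial R σ F = ∑ J, cubeCoeff R J F • X ^ #J := by
    conv_lhs => rw [← sum_cubeCoeff_smul_cubeMonomial F]
    simp only [map_sum, map_smul, diagonalPolynomial_cubeMonomial]
  have hlinear : ∀ i, cubeCoeff R {i} F = F {i} - F ∅ := fun i => by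
    have hpowerset : powerset {i} = ({∅, {i}} : Finset (Finset σ)) := by
      ext B
      simp [subset_singleton_iff]
    rw [cubeCoeff_apply, hpowerset, sum_pair (singleton_ne_empty i).symm]
    simp [sub_eq_neg_add]
  calc (diagonalPolynomial R σ F).derivative.eval 0
      = ∑ J ∈ powersetCard 1 univ, cubeCoeff R J F := by
        rw [powersetCard_eq_filter, powerset_univ, sum_filter, hexpand, ← coeff_zero_eq_eval_zero,
          coeff_derivative]
        simp [coeff_X_pow, eq_comm (a := 1)]
    _ = ∑ i, cubeCoeff R {i} F := by
        rw [powersetCard_one, sum_map]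
        rfl
    _ = ∑ i, (F {i} - F ∅) := sum_congr rfl fun i _ => hlinear i

theorem abs_diagonalPolynomial_eval_le {F : Finset σ → ℝ} {K : ℝ} (hF : ∀ B, |F B| ≤ K) {t : ℝ}
    (ht : t ∈ Set.Icc 0 1) : |(diagonalPolynomial ℝ σ F).eval t| ≤ K := by
  have hweight : ∀ B : Finset σ, 0 ≤ t ^ #B * (1 - t) ^ #Bᶜ := fun B =>
    mul_nonneg (pow_nonneg ht.1 _) (pow_nonneg (sub_nonneg.2 ht.2) _)
  have hsum : ∑ B : Finset σ, t ^ #B * (1 - t) ^ #Bᶜ = 1 := by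
    have hone := congrArg (eval t) (diagonalPolynomial_cubeMonomial (R := ℝ) (∅ : Finset σ))
    simpa [diagonalPolynomial_apply, cubeMonomial_empty, eval_finsetSum] using hone
  calc |(diagonalPolynomial ℝ σ F).eval t| = |∑ B, F B * (t ^ #B * (1 - t) ^ #Bᶜ)| := by
        simp [diagonalPolynomial_apply, eval_finsetSum]
    _ ≤ ∑ B, |F B * (t ^ #B * (1 - t) ^ #Bᶜ)| := abs_sum_le_sum_abs _ _
    _ ≤ ∑ B : Finset σ, K * (t ^ #B * (1 - t) ^ #Bᶜ) := by
        refine sum_le_sum fun B _ => ?_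
        rw [abs_mul, abs_of_nonneg (hweight B)]
        exact mul_le_mul_of_nonneg_right (hF B) (hweight B)
    _ = K := by rw [← mul_sum, hsum, mul_one]

end DiagonalPolynomial

section Sensitivity

variable {σ : Type*} [DecidableEq σ]

theorem card_le_of_forall_singleton_eq_zero [Fintype σ] {d : ℕ} {F : Finset σ → ℝ}
    (hF : F ∈ cubeDegreeLE ℝ σ d) (hmax : ∀ B, |F B| ≤ |F ∅|) (hne : F ∅ ≠ 0)
    (hzero : ∀ i, F {i} = 0) : Fintype.card σ ≤ 2 * d ^ 2 := by
  have hpos : 0 < |F ∅| := abs_pos.2 hne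
  have hmarkov := abs_derivative_eval_zero_le (natDegree_diagonalPolynomial_le hF) hpos
    fun t ht => abs_diagonalPolynomial_eval_le hmax ht
  have hderiv : |(diagonalPolynomial ℝ σ F).derivative.eval 0| = Fintype.card σ * |F ∅| := by
    simp [derivative_diagonalPolynomial_eval_zero, hzero, abs_mul]
  rw [hderiv] at hmarkov
  exact_mod_cast le_of_mul_le_mul_right hmarkov hpos

theorem card_le_of_forall_symmDiff_eq_zero {ι : Type*} [Fintype ι] {d : ℕ} {F : Finset σ → ℝ}
    (hF : F ∈ cubeDegreeLE ℝ σ d) {y : Finset σ} (hmax : ∀ B, |F B| ≤ |F y|) (hne : F y ≠ 0)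
    {D : ι → Finset σ} (hD : Pairwise (Function.onFun Disjoint D))
    (hzero : ∀ k, F (symmDiff y (D k)) = 0) : Fintype.card ι ≤ 2 * d ^ 2 := by
  classical
  have hempty : symmDiff y ∅ = y := symmDiff_bot y
  exact card_le_of_forall_singleton_eq_zero (comp_symmDiff_biUnion_mem_cubeDegreeLE hF y hD)
    (fun B => by simpa [hempty] using hmax _) (by simpa [hempty] using hne)
    (fun k => by simpa using hzero k)

theorem card_le_of_pairwiseDisjoint_of_cubeCoeff_ne_zero [Finite σ] {d m : ℕ}
    {F G : Finset σ → ℝ}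
    (hF : F ∈ cubeDegreeLE ℝ σ d) (hG : G ∈ cubeDegreeLE ℝ σ m) (hFG : F * G = 0) (hF0 : F ≠ 0)
    {S : Finset (Finset σ)} (hcard : ∀ M ∈ S, #M = m) (hcoeff : ∀ M ∈ S, cubeCoeff ℝ M G ≠ 0)
    (hS : (S : Set (Finset σ)).PairwiseDisjoint id) : #S ≤ 2 * d ^ 2 := by
  obtain ⟨y, hmax⟩ := Finite.exists_max fun B => |F B|
  have hne : F y ≠ 0 := fun h => hF0 <| by
    ext B
    simpa [h] using hmax B
  have hblock : ∀ M : S, ∃ D ⊆ M.1, G (symmDiff y D) ≠ 0 := fun M =>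
    exists_subset_symmDiff_ne_zero ((hcard M M.2).symm ▸ hG) (hcoeff M M.2) y
  choose D hDM hGD using hblock
  have hD : Pairwise (Function.onFun Disjoint D) := fun M N hMN =>
    (hS M.2 N.2 (Subtype.coe_ne_coe.2 hMN)).mono (hDM M) (hDM N)
  have hzero : ∀ M, F (symmDiff y (D M)) = 0 := fun M =>
    (mul_eq_zero.1 (congrFun hFG _)).resolve_right (hGD M)
  simpa using card_le_of_forall_symmDiff_eq_zero hF hmax hne hD hzero

theorem exists_subset_pairwiseDisjoint_hitting {α : Type*} [DecidableEq α]
    (𝓜 : Finset (Finset α)) : ∃ S ⊆ 𝓜, (S : Set (Finset α)).PairwiseDisjoint id ∧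
      ∀ J ∈ 𝓜, J.Nonempty → ¬ Disjoint J (S.biUnion id) := by
  classical
  obtain ⟨S, hS⟩ := (𝓜.powerset.filter fun S : Finset (Finset α) =>
    (S : Set (Finset α)).PairwiseDisjoint id).exists_maximal ⟨∅, by simp⟩
  obtain ⟨hsub, hdisj⟩ := by simpa using hS.prop
  refine ⟨S, hsub, hdisj, fun J hJ hne hJS => ?_⟩
  rw [disjoint_biUnion_right] at hJS
  have hinsert : J ∈ S := hS.le_of_ge (y := insert J S) (by
    simp only [mem_filter, mem_powerset, insert_subset_iff, coe_insert]
    exact ⟨⟨hJ, hsub⟩, hdisj.insert fun M hM _ => hJS M hM⟩) (subset_insert J S)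
      (mem_insert_self J S)
  exact hne.ne_empty (disjoint_self.1 (hJS J hinsert))

theorem exists_hitting_card_le [Finite σ] {d m : ℕ} {F G : Finset σ → ℝ}
    (hF : F ∈ cubeDegreeLE ℝ σ d) (hG : G ∈ cubeDegreeLE ℝ σ m) (hm : 0 < m) (hFG : F * G = 0)
    (hF0 : F ≠ 0) :
    ∃ U : Finset σ, #U ≤ 2 * d ^ 2 * m ∧
      ∀ J, #J = m → cubeCoeff ℝ J G ≠ 0 → ¬ Disjoint J U := by
  cases nonempty_fintype σ
  obtain ⟨S, hsub, hdisj, hhit⟩ := exists_subset_pairwiseDisjoint_hitting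
    {J : Finset σ | #J = m ∧ cubeCoeff ℝ J G ≠ 0}
  have htop : ∀ M ∈ S, #M = m ∧ cubeCoeff ℝ M G ≠ 0 := fun M hM => by simpa using hsub hM
  refine ⟨S.biUnion id, ?_, fun J hJ hcoeff => ?_⟩
  · calc #(S.biUnion id) ≤ #S * m := card_biUnion_le_card_mul _ _ _ fun M hM => (htop M hM).1.le
      _ ≤ 2 * d ^ 2 * m := Nat.mul_le_mul_right m <|
        card_le_of_pairwiseDisjoint_of_cubeCoeff_ne_zero hF hG hFG hF0
          (fun M hM => (htop M hM).1) (fun M hM => (htop M hM).2) hdisj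
  · exact hhit J (by simp [hJ, hcoeff]) (card_pos.1 (hJ ▸ hm))

-- Since `0⁻¹ = 0`, the function `F⁻¹ * F` is the indicator of the support of `F`.
theorem inv_mul_self_mem_cubeDegreeLE [Finite σ] {d m : ℕ} {F G : Finset σ → ℝ}
    (hF : F ∈ cubeDegreeLE ℝ σ d) (hG : G ∈ cubeDegreeLE ℝ σ m) (hFG : F * G = 0)
    (hcommon : ∀ B, F B = 0 → G B ≠ 0) :
    F⁻¹ * F ∈ cubeDegreeLE ℝ σ (d ^ 2 * (m * (m + 1))) := by
  induction m generalizing F G with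
  | zero =>
    rw [cubeDegreeLE_zero] at hG
    obtain ⟨c, rfl⟩ := Submodule.mem_span_singleton.1 hG
    rcases eq_or_ne c 0 with rfl | hc
    · have hone : F⁻¹ * F = 1 := funext fun B => inv_mul_cancel₀ fun hB => by
        simpa using hcommon B hB
      exact hone ▸ one_mem_cubeDegreeLE _
    · have hzero : F = 0 := by simpa [hc] using hFG
      simp [hzero]
  | succ m ih =>
    rcases eq_or_ne F 0 with rfl | hF0
    · simp
    obtain ⟨U, hUcard, hU⟩ := exists_hitting_card_le hF hG m.succ_pos hFG hF0
    have hdeg : #U + d ^ 2 * (m * (m + 1)) ≤ d ^ 2 * ((m + 1) * (m + 1 + 1)) := by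
      linarith
    refine cubeDegreeLE_mono hdeg <| mem_cubeDegreeLE_of_forall_comp_overwrite fun A _ => ?_
    exact ih (comp_overwrite_mem_cubeDegreeLE hF U A)
      (comp_overwrite_mem_cubeDegreeLE_of_hitting hG hU A)
      (funext fun B => congrFun hFG (overwrite U A B)) fun B => hcommon (overwrite U A B)

end Sensitivity

section Interpolation

open MvPolynomial

variable {R : Type*} [CommRing R] {σ : Type*} [DecidableEq σ]

variable (R) in
/-- The point of `{0,1}^σ` with support `B`. -/
def cubePoint (B : Finset σ) (i : σ) : R := cubeMonomial R {i} B

variable (R σ) in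
/-- The function on the cube `{0,1}^σ` given by a polynomial. -/
noncomputable def cubeEval : MvPolynomial σ R →ₐ[R] (Finset σ → R) :=
  aeval fun i => cubeMonomial R {i}

theorem cubeEval_apply (p : MvPolynomial σ R) (B : Finset σ) :
    cubeEval R σ p B = eval (cubePoint R B) p := by
  simp [cubeEval, aeval_def, eval₂_eq, eval_eq, cubePoint, Algebra.algebraMap_eq_smul_one]

theorem cubeEval_eq_sum (p : MvPolynomial σ R) :
    cubeEval R σ p = ∑ s ∈ p.support, p.coeff s • cubeMonomial R s.support := by
  have hidem : ∀ i : σ, IsIdempotentElem (cubeMonomial R {i}) := fun i => by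
    rw [IsIdempotentElem, cubeMonomial_mul_cubeMonomial, union_self]
  rw [cubeEval, aeval_def, eval₂_eq]
  refine sum_congr rfl fun s _ => ?_
  rw [← Algebra.smul_def, ← prod_cubeMonomial_singleton]
  exact congrArg _ <| prod_congr rfl fun i hi => (hidem i).pow_eq (Finsupp.mem_support_iff.1 hi)

theorem cubeEval_mem_cubeDegreeLE (p : MvPolynomial σ R) :
    cubeEval R σ p ∈ cubeDegreeLE R σ p.totalDegree := by
  rw [cubeEval_eq_sum]
  refine sum_mem fun s hs => Submodule.smul_mem _ _ <| cubeMonomial_mem_cubeDegreeLE ?_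
  calc #s.support ≤ ∑ i ∈ s.support, s i := by
        simpa using card_nsmul_le_sum s.support s 1 fun i hi =>
          Nat.one_le_iff_ne_zero.2 (Finsupp.mem_support_iff.1 hi)
    _ ≤ p.totalDegree := le_totalDegree hs

variable [Fintype σ]

variable (R σ) in
/-- The multilinear polynomial with prescribed values on the cube `{0,1}^σ`. -/
noncomputable def cubeInterpolant : (Finset σ → R) →ₗ[R] MvPolynomial σ R :=
  ∑ J, (cubeCoeff R J).smulRight (∏ i ∈ J, X i)

theorem cubeInterpolant_apply (F : Finset σ → R) :
    cubeInterpolant R σ F = ∑ J, cubeCoeff R J F • ∏ i ∈ J, X i := by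
  simp [cubeInterpolant]

theorem cubeInterpolant_cubeMonomial (J : Finset σ) :
    cubeInterpolant R σ (cubeMonomial R J) = ∏ i ∈ J, X i := by
  simp [cubeInterpolant_apply, cubeCoeff_cubeMonomial]

theorem cubeEval_cubeInterpolant (F : Finset σ → R) :
    cubeEval R σ (cubeInterpolant R σ F) = F := by
  conv_rhs => rw [← sum_cubeCoeff_smul_cubeMonomial F]
  simp [cubeInterpolant_apply, cubeEval, prod_cubeMonomial_singleton]

theorem totalDegree_cubeInterpolant_le {d : ℕ} {F : Finset σ → R}
    (hF : F ∈ cubeDegreeLE R σ d) : (cubeInterpolant R σ F).totalDegree ≤ d := by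
  rw [cubeInterpolant_apply]
  refine totalDegree_finsetSum_le fun J _ => ?_
  by_cases hJ : cubeCoeff R J F = 0
  · simp [hJ]
  calc (cubeCoeff R J F • ∏ i ∈ J, X i).totalDegree
      ≤ (∏ i ∈ J, (X i : MvPolynomial σ R)).totalDegree := totalDegree_smul_le _ _
    _ ≤ ∑ i ∈ J, (X i : MvPolynomial σ R).totalDegree := totalDegree_finsetProd _ _
    _ ≤ #J := by
        have := nontrivial_of_ne _ _ hJ
        simp
    _ ≤ d := card_le_of_cubeCoeff_ne_zero hF hJ

theorem multilinearization_eq_cubeInterpolant {n : ℕ} (p : MvPolynomial (Fin n) ℝ) :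
    multilinearization p = cubeInterpolant ℝ (Fin n) (cubeEval ℝ (Fin n) p) := by
  simp only [multilinearization, cubeEval_eq_sum, map_sum, map_smul, cubeInterpolant_cubeMonomial,
    smul_eq_C_mul]

theorem totalDegree_multilinearization_le {n d : ℕ} {p : MvPolynomial (Fin n) ℝ}
    (hp : cubeEval ℝ (Fin n) p ∈ cubeDegreeLE ℝ (Fin n) d) :
    (multilinearization p).totalDegree ≤ d :=
  multilinearization_eq_cubeInterpolant p ▸ totalDegree_cubeInterpolant_le hp

theorem hypercube_eq_range_cubePoint (n : ℕ) :
    hypercube n = Set.range (cubePoint ℝ : Finset (Fin n) → Fin n → ℝ) := by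
  ext x
  refine ⟨fun hx => ⟨univ.filter fun i => x i = 1, funext fun i => ?_⟩, ?_⟩
  · rcases hx i with h | h <;> simp [cubePoint, cubeMonomial, h]
  · rintro ⟨B, rfl⟩ i
    simp only [cubePoint, cubeMonomial]
    split_ifs <;> simp

end Interpolation

theorem mainTheorem6 (n : ℕ) (g₁ g₂ : MvPolynomial (Fin n) ℝ)
    (hcommon : ¬ ∃ x ∈ hypercube n, MvPolynomial.eval x g₁ = 0 ∧ MvPolynomial.eval x g₂ = 0)
    (hprod : ∀ x ∈ hypercube n, MvPolynomial.eval x g₁ * MvPolynomial.eval x g₂ = 0) :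
    ∃ h₁ h₂ : MvPolynomial (Fin n) ℝ,
      (∀ x ∈ hypercube n,
        MvPolynomial.eval x h₁ * MvPolynomial.eval x g₁
          + MvPolynomial.eval x h₂ * MvPolynomial.eval x g₂ = 1) ∧
      max (multilinearization (h₁ * g₁)).totalDegree (multilinearization (h₂ * g₂)).totalDegree
        ≤ 2 * g₁.totalDegree ^ 2 * g₂.totalDegree ^ 2 := by
  simp only [hypercube_eq_range_cubePoint, Set.exists_range_iff, Set.forall_mem_range,
    ← cubeEval_apply, not_exists, not_and] at hcommon hprod ⊢
  set F := cubeEval ℝ (Fin n) g₁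
  set G := cubeEval ℝ (Fin n) g₂
  have hF : F⁻¹ * F ∈ cubeDegreeLE ℝ (Fin n) (2 * g₁.totalDegree ^ 2 * g₂.totalDegree ^ 2) := by
    refine cubeDegreeLE_mono ?_ <| inv_mul_self_mem_cubeDegreeLE (cubeEval_mem_cubeDegreeLE g₁)
      (cubeEval_mem_cubeDegreeLE g₂) (funext hprod) hcommon
    nlinarith [Nat.mul_le_mul_left (g₁.totalDegree ^ 2)
      (Nat.le_self_pow two_ne_zero g₂.totalDegree)]
  have hG : G⁻¹ * G = 1 - F⁻¹ * F := by
    ext B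
    rcases mul_eq_zero.1 (hprod B) with hFB | hGB
    · simp [hFB, hcommon B hFB]
    · have hFB : F B ≠ 0 := fun h => hcommon B h hGB
      simp [hGB, hFB]
  refine ⟨cubeInterpolant ℝ _ F⁻¹, cubeInterpolant ℝ _ G⁻¹, fun B => ?_, max_le ?_ ?_⟩
  · rw [cubeEval_cubeInterpolant, cubeEval_cubeInterpolant]
    exact congrFun (eq_sub_iff_add_eq'.1 hG) B
  · exact totalDegree_multilinearization_le (by rwa [map_mul, cubeEval_cubeInterpolant])
  · refine totalDegree_multilinearization_le ?_
    rw [map_mul, cubeEval_cubeInterpolant, hG]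
    exact sub_mem (one_mem_cubeDegreeLE _) hF
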